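/- **Proposition.** Let $N\ge 1$ and let $K^{(1)},\dots,K^{(N)}$ be block sizes, with $L=\sum_{i=1}^N K^{(i)}$ and $K=\max_i K^{(i)}\ge 2$. For an $L\times L$ matrix $M$ write $M^{(i,i)}\in\mathbb{R}^{K^{(i)}\times K^{(i)}}$ for its $i$-th diagonal block. Let $\beta>0$, let $A\in\mathbb{R}^{L\times L}$ be a symmetric cost matrix and let $\Lambda^{(i)}\in\mathbb{R}^{K^{(i)}\times K^{(i)}}$, $i=1,\dots,N$, be symmetric. Put $$X=\exp\Big(-\beta\Big(A-\bigoplus_{i=1}^N\Lambda^{(i)}\Big)\Big),\qquad \hat X=\frac1S\,X^{1/2}ZZ^\top X^{1/2},$$ where $Z\in\mathbb{R}^{L\times S}$ has i.i.d. standard Gaussian entries. For every $\delta_0\in(0,1)$ there is a constant $C>0$, depending only on $\delta_0$, such that the following holds for all such data and all $\varepsilon,\delta\in(0,1)$ with $N\ge 2$ or $\delta\le\delta_0$. (In particular, for $N\ge2$ the constant can be taken absolute.) If $$S\ \ge\ \frac{C\,\log(N/\delta)}{\varepsilon^2}\,K\log K,$$ then with probability at least $1-\delta$, simultaneously for all $i=1,\dots,N$,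 $$(1-\varepsilon)\,X^{(i,i)}\preceq \hat X^{(i,i)}\preceq(1+\varepsilon)\,X^{(i,i)}\qquad\text{and}\qquad \big\|\log\hat X^{(i,i)}-\log X^{(i,i)}\big\|\le|\log(1-\varepsilon)|,$$ where $\preceq$ is the Loewner order, $\log$ of a positive definite matrix is the matrix logarithm, and $\|\cdot\|$ is the spectral norm. Moreover, for every realization of $Z$ and every $i$, the first pair of inequalities implies the logarithm bound. -/

import Mathlib

open MeasureTheory ProbabilityTheory
open scoped Matrix MatrixOrder Matrix.Norms.L2Operator

namespace BlockSketch

/-- Row and column indices of the large matrices: pairs `(i, k)` of a block `i` and a position `k`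
in that block. There are `L = ∑ i, K i` of them. -/
abbrev Idx {N : ℕ} (K : Fin N → ℕ) : Type := (i : Fin N) × Fin (K i)

/-- The largest block size, `max_i K i`. -/
def maxBlock {N : ℕ} (K : Fin N → ℕ) : ℕ := Finset.univ.sup K

noncomputable section

/-- The effective cost matrix `C - ⨁ i, Λ i`. -/
def effCost {N : ℕ} {K : Fin N → ℕ} (cost : Matrix (Idx K) (Idx K) ℝ)
    (Lam : (i : Fin N) → Matrix (Fin (K i)) (Fin (K i)) ℝ) : Matrix (Idx K) (Idx K) ℝ :=
  cost - Matrix.blockDiagonal' Lam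

/-- The primal matrix `X = exp (-β (C - ⨁ i, Λ i))`. -/
def primal {N : ℕ} {K : Fin N → ℕ} (β : ℝ) (cost : Matrix (Idx K) (Idx K) ℝ)
    (Lam : (i : Fin N) → Matrix (Fin (K i)) (Fin (K i)) ℝ) : Matrix (Idx K) (Idx K) ℝ :=
  NormedSpace.exp (-β • effCost cost Lam)

/-- The sketched estimator `X^{1/2} Z Zᵀ X^{1/2} / S`, where `X^{1/2}` is the positive
semidefinite square root. -/
def sketch {N : ℕ} {K : Fin N → ℕ} {S : ℕ} (X : Matrix (Idx K) (Idx K) ℝ)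
    (Z : Matrix (Idx K) (Fin S) ℝ) : Matrix (Idx K) (Idx K) ℝ :=
  (1 / (S : ℝ)) • (CFC.sqrt X * Z * Zᵀ * CFC.sqrt X)

/-- `Z` is a random matrix with i.i.d. standard Gaussian entries. -/
structure IsGaussianSketch {Ω : Type*} [MeasurableSpace Ω] {m n : Type*}
    (Z : Ω → Matrix m n ℝ) (μ : Measure Ω) : Prop where
  hasLaw : ∀ k s, HasLaw (fun ω => Z ω k s) (gaussianReal 0 1) μ
  indep : iIndepFun (fun (p : m × n) ω => Z ω p.1 p.2) μ

/-- `(1 - ε) A ⪯ B ⪯ (1 + ε) A` in the Loewner order. -/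
def RelClose {n : Type*} [Fintype n] (ε : ℝ) (A B : Matrix n n ℝ) : Prop :=
  (1 - ε) • A ≤ B ∧ B ≤ (1 + ε) • A

end

end BlockSketch

/-! Let `W` collect the columns of `X^{1/2}` in block `i`. Then `X^{(i,i)} = Wᵀ W` and the sketched
block is `Wᵀ Z Zᵀ W / S`, so relative closeness says that `‖Zᵀ u‖² / S` is within `ε ‖u‖²` of `‖u‖²`
for every `u` in the column space of `W`. That space has dimension at most `K i`, whatever `L` is,
and a `1/2`-net of its unit sphere with at most `5 ^ K i` points suffices (`exists_net_relClose`,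
through `abs_le_of_abs_le_on_net`). At a fixed unit vector, `‖Zᵀ u‖²` is chi-squared with `S`
degrees of freedom and concentrates (`measureReal_abs_sum_sq_sub_ge`). A union bound over blocks and
net points gives the probability; `union_bound_le` fixes the sample size.

The logarithm bound is deterministic: operator monotonicity of `log` (`log_le_log`) turns the
factors `1 ± ε` into additive shifts. -/

namespace BlockSketch

/-! ### Chi-squared concentration -/

section Gaussian

variable {Ω : Type*} [MeasurableSpace Ω] {μ : Measure Ω}

/-- If the entries of a random array are independent, then so are its rows. -/
lemma iIndepFun_curry {ι κ E : Type*} [Countable ι] [Countable κ] [MeasurableSpace E]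
    {X : ι × κ → Ω → E} (hX : ∀ p, AEMeasurable (X p) μ) (h : iIndepFun X μ) :
    iIndepFun (fun i ω k => X (i, k) ω) μ := by
  have := h.isProbabilityMeasure
  have hprob : ∀ i k, IsProbabilityMeasure (μ.map (X (i, k))) := fun i k =>
    Measure.isProbabilityMeasure_map (hX (i, k))
  have hrow : ∀ i, AEMeasurable (fun ω k => X (i, k) ω) μ := fun i =>
    aemeasurable_pi_lambda _ fun k => hX (i, k)
  rw [iIndepFun_iff_map_fun_eq_infinitePi_map₀' hrow]
  have hcurry : (fun ω i k => X (i, k) ω)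
      = (MeasurableEquiv.curry ι κ E) ∘ (fun ω p => X p ω) := rfl
  rw [hcurry, ← AEMeasurable.map_map_of_aemeasurable (by fun_prop)
    (aemeasurable_pi_lambda _ hX), h.map_fun_eq_infinitePi_map₀' hX,
    Measure.infinitePi_map_curry (fun i k => μ.map (X (i, k)))]
  congr with i : 1
  exact ((h.precomp (Prod.mk_right_injective i)).map_fun_eq_infinitePi_map₀'
    fun k => hX (i, k)).symm

/-- A linear combination of independent standard Gaussian variables is Gaussian. -/
lemma hasLaw_sum_mul_gaussian {κ : Type*} [Fintype κ] {g : κ → Ω → ℝ}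
    (hg : ∀ k, HasLaw (g k) (gaussianReal 0 1) μ) (hind : iIndepFun g μ) (a : κ → ℝ) :
    HasLaw (fun ω => ∑ k, a k * g k ω) (gaussianReal 0 (∑ k, Real.nnabs (a k) ^ 2)) μ := by
  classical
  have := hind.isProbabilityMeasure
  have hlaw : ∀ k, HasLaw (fun ω => a k * g k ω) (gaussianReal 0 (Real.nnabs (a k) ^ 2)) μ := by
    intro k
    convert gaussianReal_const_mul (hg k) (a k) using 2
    · simp
    · ext; simp
  have hind' : iIndepFun (fun k ω => a k * g k ω) μ :=
    hind.comp (fun k x => a k * x) fun k => by fun_prop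
  suffices ∀ s : Finset κ, HasLaw (fun ω => ∑ k ∈ s, a k * g k ω)
      (gaussianReal 0 (∑ k ∈ s, Real.nnabs (a k) ^ 2)) μ from this Finset.univ
  intro s
  induction s using Finset.induction_on with
  | empty =>
    simp only [Finset.sum_empty, gaussianReal_zero_var]
    exact ⟨by fun_prop, by simp⟩
  | insert k s hk ih =>
    refine ⟨Finset.aemeasurable_fun_sum _ fun j _ => (hlaw j).aemeasurable, ?_⟩
    have h := gaussianReal_add_gaussianReal_of_indepFun
      (X := fun ω => ∑ k ∈ s, a k * g k ω) (Y := fun ω => a k * g k ω) ?_ ih.map_eq (hlaw k).map_eq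
    · rw [Finset.sum_insert hk, add_comm, ← zero_add (0 : ℝ), ← h]
      congr 1
      ext ω
      simp [Finset.sum_insert hk, add_comm]
    · have := hind'.indepFun_finsetSum_of_notMem₀ (fun j => (hlaw j).aemeasurable) hk
      convert this using 1
      ext ω
      simp

lemma gaussianPDFReal_mul_exp_sq (c x : ℝ) :
    gaussianPDFReal 0 1 x * Real.exp (c * x ^ 2)
      = (√(2 * Real.pi))⁻¹ * Real.exp (-(1 / 2 - c) * x ^ 2) := by
  simp only [gaussianPDFReal, NNReal.coe_one, mul_one, sub_zero, mul_assoc, ← Real.exp_add]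
  congr 2
  ring

lemma integral_exp_sq_gaussianReal {c : ℝ} (hc : c < 1 / 2) :
    ∫ x, Real.exp (c * x ^ 2) ∂(gaussianReal 0 1) = (√(1 - 2 * c))⁻¹ := by
  rw [integral_gaussianReal_eq_integral_smul one_ne_zero]
  simp only [smul_eq_mul, gaussianPDFReal_mul_exp_sq]
  rw [integral_const_mul, integral_gaussian, ← Real.sqrt_inv, ← Real.sqrt_inv,
    ← Real.sqrt_mul (by positivity)]
  congr 1
  have : (1 / 2 - c) ≠ 0 := by linarith
  have : (1 - 2 * c) ≠ 0 := by linarith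
  field_simp

/-- First-order Taylor bound for `log (1 - 2c)`: the remainder is at most `8 c²` because `1 - |2c| ≥
1/2`, and the square root halves it. -/
lemma inv_sqrt_le_exp {c : ℝ} (hc : |c| ≤ 1 / 4) :
    (√(1 - 2 * c))⁻¹ ≤ Real.exp (c + 4 * c ^ 2) := by
  have habs := abs_le.mp hc
  have hpos : 0 < 1 - 2 * c := by linarith
  have hlog := Real.abs_log_sub_add_sum_range_le (x := 2 * c)
    (by rw [abs_mul, abs_two]; linarith) 1
  simp only [Finset.range_one, Finset.sum_singleton, zero_add, pow_one, Nat.cast_zero, div_one,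
    Nat.reduceAdd, sq_abs] at hlog
  have hbound : (2 * c) ^ 2 / (1 - |2 * c|) ≤ 8 * c ^ 2 := by
    rw [div_le_iff₀ (by rw [abs_mul, abs_two]; linarith), abs_mul, abs_two]
    nlinarith [sq_nonneg c]
  have hlog' := (abs_le.mp (hlog.trans hbound)).1
  rw [← Real.exp_log (inv_pos.mpr (Real.sqrt_pos.mpr hpos)), Real.log_inv,
    Real.log_sqrt hpos.le]
  gcongr
  linarith

/-- The moment generating function of a chi-squared variable near the origin. -/
lemma mgf_sum_gaussian_sq_le {σ : Type*} [Fintype σ] {g : σ → Ω → ℝ}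
    (hg : ∀ s, HasLaw (g s) (gaussianReal 0 1) μ) (hind : iIndepFun g μ) {c : ℝ}
    (hc : |c| ≤ 1 / 4) :
    Integrable (fun ω => Real.exp (c * ∑ s, g s ω ^ 2)) μ ∧
      mgf (fun ω => ∑ s, g s ω ^ 2) μ c ≤ Real.exp (Fintype.card σ * (c + 4 * c ^ 2)) := by
  have := hind.isProbabilityMeasure
  have hc' : c < 1 / 2 := by linarith [le_abs_self c]
  have hind' : iIndepFun (fun s ω => g s ω ^ 2) μ :=
    hind.comp (fun _ x => x ^ 2) fun _ => by fun_prop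
  have hmeas : ∀ s, AEMeasurable (fun ω => g s ω ^ 2) μ := fun s =>
    (hg s).aemeasurable.pow_const 2
  have hsum : (∑ s, fun ω => g s ω ^ 2) = fun ω => ∑ s, g s ω ^ 2 := by ext; simp
  have hmgf : mgf (fun ω => ∑ s, g s ω ^ 2) μ c = (√(1 - 2 * c))⁻¹ ^ Fintype.card σ := by
    rw [← hsum, hind'.mgf_sum₀ hmeas, ← Finset.card_univ, ← Finset.prod_const]
    refine Finset.prod_congr rfl fun s _ => ?_
    rw [← integral_exp_sq_gaussianReal hc', ← (hg s).map_eq,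
      integral_map (hg s).aemeasurable (by fun_prop)]
    rfl
  constructor
  -- A non-integrable function has Bochner integral zero, so the closed form of the mgf already
  -- gives integrability.
  · refine Integrable.of_integral_ne_zero ?_
    change mgf (fun ω => ∑ s, g s ω ^ 2) μ c ≠ 0
    rw [hmgf]
    exact (pow_pos (inv_pos.mpr (Real.sqrt_pos.mpr (by linarith))) _).ne'
  · rw [hmgf, Real.exp_nat_mul]
    gcongr
    exact inv_sqrt_le_exp hc

/-- Concentration of a chi-squared variable around its mean. -/
lemma measureReal_abs_sum_sq_sub_ge {σ : Type*} [Fintype σ] {g : σ → Ω → ℝ}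
    (hg : ∀ s, HasLaw (g s) (gaussianReal 0 1) μ) (hind : iIndepFun g μ) {t : ℝ}
    (ht : 0 ≤ t) (ht1 : t ≤ 1) :
    μ.real {ω | Fintype.card σ * t ≤ |∑ s, g s ω ^ 2 - Fintype.card σ|}
      ≤ 2 * Real.exp (-(Fintype.card σ * t ^ 2 / 16)) := by
  have := hind.isProbabilityMeasure
  set n : ℝ := (Fintype.card σ : ℝ)
  -- Chernoff at `c = t / 8`, the minimizer of `4 c² - c t`, whose minimum is `-t² / 16`.
  have habs : |t / 8| ≤ 1 / 4 := by rw [abs_of_nonneg (by linarith)]; linarith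
  have habs' : |-(t / 8)| ≤ 1 / 4 := by rwa [abs_neg]
  obtain ⟨hi, hm⟩ := mgf_sum_gaussian_sq_le hg hind habs
  obtain ⟨hi', hm'⟩ := mgf_sum_gaussian_sq_le hg hind habs'
  have hup : μ.real {ω | n + n * t ≤ ∑ s, g s ω ^ 2} ≤ Real.exp (-(n * t ^ 2 / 16)) := by
    refine (measure_ge_le_exp_mul_mgf _ (by linarith) hi).trans ?_
    refine (mul_le_mul_of_nonneg_left hm (Real.exp_pos _).le).trans (le_of_eq ?_)
    rw [← Real.exp_add]
    congr 1
    ring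
  have hlow : μ.real {ω | ∑ s, g s ω ^ 2 ≤ n - n * t} ≤ Real.exp (-(n * t ^ 2 / 16)) := by
    refine (measure_le_le_exp_mul_mgf _ (by linarith) hi').trans ?_
    refine (mul_le_mul_of_nonneg_left hm' (Real.exp_pos _).le).trans (le_of_eq ?_)
    rw [← Real.exp_add]
    congr 1
    ring
  have hsub : {ω | n * t ≤ |∑ s, g s ω ^ 2 - n|} ⊆
      {ω | n + n * t ≤ ∑ s, g s ω ^ 2} ∪ {ω | ∑ s, g s ω ^ 2 ≤ n - n * t} := by
    intro ω hω
    rcases le_abs.mp (show n * t ≤ |∑ s, g s ω ^ 2 - n| from hω) with h | h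
    · left; show n + n * t ≤ ∑ s, g s ω ^ 2; linarith
    · right; show ∑ s, g s ω ^ 2 ≤ n - n * t; linarith
  have := (measureReal_mono (μ := μ) hsub).trans (measureReal_union_le _ _)
  linarith

/-- For a fixed unit vector `a`, the quadratic form of the normalized Wishart matrix at `a`
concentrates around one. -/
lemma IsGaussianSketch.measureReal_abs_sub_ge {m n : Type*} [Fintype m] [Fintype n]
    {Z : Ω → Matrix m n ℝ} (hZ : IsGaussianSketch Z μ) {a : m → ℝ} (ha : ∑ k, a k ^ 2 = 1)
    {t : ℝ} (ht : 0 ≤ t) (ht1 : t ≤ 1) :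
    μ.real {ω | Fintype.card n * t ≤ |∑ s, (∑ k, a k * Z ω k s) ^ 2 - Fintype.card n|}
      ≤ 2 * Real.exp (-(Fintype.card n * t ^ 2 / 16)) := by
  refine measureReal_abs_sum_sq_sub_ge (g := fun s ω => ∑ k, a k * Z ω k s) (fun s => ?_) ?_ ht ht1
  · have h := hasLaw_sum_mul_gaussian (fun k => hZ.hasLaw k s)
      (hZ.indep.precomp (g := fun k => (k, s)) fun _ _ h => (Prod.mk.inj h).1) a
    have hvar : ∑ k, Real.nnabs (a k) ^ 2 = 1 := by ext; simpa using ha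
    rwa [hvar] at h
  · have hcol : iIndepFun (fun s ω k => Z ω k s) μ :=
      iIndepFun_curry (X := fun (p : n × m) ω => Z ω p.2 p.1)
        (fun p => (hZ.hasLaw p.2 p.1).aemeasurable)
        (hZ.indep.precomp (g := Prod.swap) Prod.swap_injective)
    exact hcol.comp (fun _ z => ∑ k, a k * z k) fun _ => by fun_prop

end Gaussian

/-! ### Nets and quadratic forms on the sphere -/

section Net

/-- The unit sphere of a `d`-dimensional space has a `1/2`-net with at most `5 ^ d` points. -/
lemma exists_half_net_sphere (E : Type*) [NormedAddCommGroup E] [NormedSpace ℝ E]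
    [FiniteDimensional ℝ E] :
    ∃ s : Finset E, s.card ≤ 5 ^ Module.finrank ℝ E ∧ (∀ y ∈ s, ‖y‖ = 1) ∧
      ∀ x : E, ‖x‖ = 1 → ∃ y ∈ s, ‖y - x‖ ≤ 1 / 2 := by
  classical
  let Sep : Finset E → Prop := fun s =>
    (∀ y ∈ s, ‖y‖ = 1) ∧ ∀ y ∈ s, ∀ z ∈ s, y ≠ z → 1 / 2 ≤ ‖y - z‖
  have hcard : ∀ s, Sep s → s.card ≤ 5 ^ Module.finrank ℝ E := by
    rintro s ⟨hunit, hsep⟩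
    -- Doubling gives a `1`-separated set in the ball of radius `2`, the normalization of the
    -- Besicovitch count.
    have hinj : Function.Injective (fun y : E => (2 : ℝ) • y) :=
      smul_right_injective E two_ne_zero
    rw [← Finset.card_image_of_injective s hinj]
    refine Besicovitch.card_le_of_separated _ ?_ ?_
    · simp only [Finset.forall_mem_image, norm_smul, Real.norm_ofNat]
      intro y hy
      rw [hunit y hy]
      norm_num
    · simp only [Finset.forall_mem_image]
      intro y hy z hz hne
      rw [← smul_sub, norm_smul, Real.norm_ofNat]
      linarith [hsep y hy z hz fun h => hne (by rw [h])]
  -- A separated set of maximal cardinality is a net: a point far from all of it could be added.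
  let cards : Set ℕ := {n | ∃ s, Sep s ∧ s.card = n}
  have hne : cards.Nonempty := ⟨0, ∅, by simp [Sep], rfl⟩
  have hbdd : BddAbove cards := ⟨5 ^ Module.finrank ℝ E, by
    rintro _ ⟨s, hs, rfl⟩; exact hcard s hs⟩
  obtain ⟨s, hs, hmax⟩ := Nat.sSup_mem hne hbdd
  refine ⟨s, hcard s hs, hs.1, fun x hx => ?_⟩
  by_contra! hfar
  have hxs : x ∉ s := fun h => by
    have := hfar x h
    norm_num at this
  have hins : Sep (insert x s) := by
    refine ⟨by simpa [hx] using hs.1, ?_⟩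
    simp only [Finset.mem_insert]
    rintro y (rfl | hy) z (rfl | hz) hyz
    · exact absurd rfl hyz
    · rw [norm_sub_rev]; exact (hfar z hz).le
    · exact (hfar y hy).le
    · exact hs.2 y hy z hz hyz
  have hle := le_csSup hbdd ⟨_, hins, rfl⟩
  rw [← hmax, Finset.card_insert_of_notMem hxs] at hle
  omega

/-- A quadratic form that is at most `ε / 2` in absolute value on a `1/2`-net of the unit sphere
is at most `ε` in absolute value on the unit sphere. -/
lemma abs_le_of_abs_le_on_net {E : Type*} [NormedAddCommGroup E] [InnerProductSpace ℝ E]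
    [FiniteDimensional ℝ E] {s : Set E} (hunit : ∀ y ∈ s, ‖y‖ = 1)
    (hnet : ∀ x : E, ‖x‖ = 1 → ∃ y ∈ s, ‖y - x‖ ≤ 1 / 2)
    (B : E →ₗ[ℝ] E →ₗ[ℝ] ℝ) (hB : ∀ x y, B x y = B y x) {ε : ℝ} (hε : 0 ≤ ε)
    (hs : ∀ y ∈ s, |B y y| ≤ ε / 2) (x : E) : |B x x| ≤ ε * ‖x‖ ^ 2 := by
  rcases subsingleton_or_nontrivial E with hE | hE
  · simp [Subsingleton.elim x 0]
  have hcont : Continuous fun x => B x x := by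
    have : (fun x => B x x) = fun x => (LinearMap.toContinuousLinearMap
        ((LinearMap.toContinuousLinearMap (𝕜 := ℝ) (E := E) (F' := ℝ)).toLinearMap ∘ₗ B)) x x := rfl
    rw [this]
    fun_prop
  obtain ⟨x₀, hx₀, hmax⟩ := (isCompact_sphere (0 : E) 1).exists_isMaxOn
    (NormedSpace.sphere_nonempty.mpr zero_le_one) hcont.abs.continuousOn
  have hx₀ : ‖x₀‖ = 1 := by simpa using hx₀
  set m := |B x₀ x₀| with hm
  have hall : ∀ y, |B y y| ≤ m * ‖y‖ ^ 2 := by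
    intro y
    rcases eq_or_ne y 0 with rfl | hy
    · simp
    have hny : ‖y‖ ≠ 0 := norm_ne_zero_iff.mpr hy
    have h := hmax (show ‖y‖⁻¹ • y ∈ Metric.sphere (0 : E) 1 by simp [norm_smul, hny])
    simp only [map_smul, LinearMap.smul_apply, smul_eq_mul, Set.mem_ofPred_eq, abs_mul, abs_inv,
      abs_norm] at h
    field_simp at h
    rwa [mul_comm] at h
  suffices m ≤ ε from (hall x).trans (by gcongr)
  obtain ⟨σ, hσ, hσm⟩ : ∃ σ : ℝ, |σ| = 1 ∧ σ * B x₀ x₀ = m := by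
    rcases abs_choice (B x₀ x₀) with h | h
    · exact ⟨1, by simp, by rw [hm, h, one_mul]⟩
    · exact ⟨-1, by simp, by rw [hm, h]; ring⟩
  -- `A y y = m ‖y‖² - σ B y y` is positive semidefinite and vanishes at `x₀`
  have hup : ∀ y, σ * B y y ≤ m * ‖y‖ ^ 2 := fun y => by
    refine (le_abs_self _).trans ?_
    rw [abs_mul, hσ, one_mul]; exact hall y
  have hlow : ∀ y, -(m * ‖y‖ ^ 2) ≤ σ * B y y := fun y => by
    refine neg_le_of_abs_le ?_
    rw [abs_mul, hσ, one_mul]; exact hall y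
  -- A semidefinite form that vanishes at `x₀` has `x₀` in its kernel: along `x₀ + t w` it is a
  -- nonnegative quadratic in `t` without constant term, so its discriminant kills the linear term.
  have hker : ∀ w, m * inner ℝ x₀ w - σ * B x₀ w = 0 := by
    intro w
    have hquad : ∀ t : ℝ, 0 ≤ (m * ‖w‖ ^ 2 - σ * B w w) * (t * t)
        + (2 * (m * inner ℝ x₀ w - σ * B x₀ w)) * t + 0 := by
      intro t
      have h := hup (x₀ + t • w)
      rw [norm_add_sq_real, inner_smul_right, norm_smul, mul_pow, Real.norm_eq_abs, sq_abs,
        hx₀] at h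
      simp only [map_add, map_smul, LinearMap.add_apply, LinearMap.smul_apply, smul_eq_mul,
        hB w x₀] at h
      nlinarith
    have hdisc := discrim_le_zero hquad
    rw [discrim] at hdisc
    nlinarith [sq_nonneg (m * inner ℝ x₀ w - σ * B x₀ w)]
  obtain ⟨y, hy, hxy⟩ := hnet x₀ hx₀
  -- The loss is quadratic in `‖y - x₀‖`, at most `2m · (1/4) = m/2`; hence `m/2 ≤ σ B y y ≤ ε/2`.
  have hyexp : σ * B y y = m - (m * ‖y - x₀‖ ^ 2 - σ * B (y - x₀) (y - x₀)) := by
    have h1 := hker y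
    have h2 : ‖y - x₀‖ ^ 2 = 2 - 2 * inner ℝ x₀ y := by
      rw [norm_sub_sq_real, hunit y hy, hx₀, real_inner_comm]; ring
    simp only [map_sub, LinearMap.sub_apply, hB y x₀]
    rw [h2]
    linarith
  have hyσ : σ * B y y ≤ ε / 2 := by
    refine (le_abs_self _).trans ?_
    rw [abs_mul, hσ, one_mul]; exact hs y hy
  have hsq : ‖y - x₀‖ ^ 2 ≤ 1 / 4 := by nlinarith [norm_nonneg (y - x₀)]
  nlinarith [hlow (y - x₀), abs_nonneg (B x₀ x₀)]

end Net

/-! ### Operator monotonicity of the logarithm -/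

section Log

open scoped ComplexOrder

variable {n : Type*} [Fintype n] [DecidableEq n]

/-- The inclusion of real matrices into complex matrices. -/
noncomputable def complexify : Matrix n n ℝ →⋆ₐ[ℝ] Matrix n n ℂ where
  toAlgHom := (Algebra.ofId ℝ ℂ).mapMatrix
  map_star' A := by
    ext i j
    simp [Matrix.star_apply, Algebra.ofId_apply]

lemma complexify_apply (A : Matrix n n ℝ) : complexify A = A.map ((↑) : ℝ → ℂ) := rfl

lemma continuous_complexify : Continuous (complexify : Matrix n n ℝ → Matrix n n ℂ) :=
  LinearMap.continuous_of_finiteDimensional (complexify (n := n)).toAlgHom.toLinearMap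

lemma posSemidef_complexify {A : Matrix n n ℝ} : (complexify A).PosSemidef ↔ A.PosSemidef := by
  constructor
  · intro h
    refine .of_dotProduct_mulVec_nonneg ?_ fun x => ?_
    · ext i j
      have := congr_fun₂ h.isHermitian i j
      simpa [complexify_apply] using this
    · have := h.dotProduct_mulVec_nonneg (fun i => (x i : ℂ))
      have hcast : star (fun i => (x i : ℂ)) ⬝ᵥ complexify A *ᵥ (fun i => (x i : ℂ))
          = ((star x ⬝ᵥ A *ᵥ x : ℝ) : ℂ) := by
        simp [dotProduct, Matrix.mulVec, complexify_apply]
      rw [hcast] at this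
      exact_mod_cast this
  · intro h
    obtain ⟨B, rfl⟩ := CStarAlgebra.nonneg_iff_eq_star_mul_self.mp h.nonneg
    rw [map_mul, map_star]
    exact Matrix.posSemidef_conjTranspose_mul_self _

lemma complexify_le_complexify {A B : Matrix n n ℝ} : complexify A ≤ complexify B ↔ A ≤ B := by
  rw [Matrix.le_iff, Matrix.le_iff, ← map_sub, posSemidef_complexify]

/-- The logarithm is operator monotone on real positive definite matrices. -/
lemma log_le_log {A B : Matrix n n ℝ} (hA : A.PosDef) (hAB : A ≤ B) : CFC.log A ≤ CFC.log B := by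
  -- Star homomorphisms commute with the functional calculus; `log` is continuous on the spectrum
  -- since positive definiteness excludes `0`. Monotonicity is thus imported from complex matrices.
  have hlog : ∀ {M : Matrix n n ℝ}, M.PosDef → complexify (CFC.log M) = CFC.log (complexify M) := by
    intro M hM
    have hsp : ∀ x ∈ spectrum ℝ M, x ≠ 0 := fun x hx h =>
      spectrum.zero_notMem ℝ hM.isUnit (h ▸ hx)
    exact complexify.map_cfc Real.log M (fun x hx =>
      (Real.continuousAt_log (hsp x hx)).continuousWithinAt) continuous_complexify
      hM.isHermitian (posSemidef_complexify.mpr hM.posSemidef).isHermitian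
  have hB : B.PosDef := by
    have := hA.add_posSemidef (Matrix.le_iff.mp hAB)
    rwa [add_sub_cancel] at this
  rw [← complexify_le_complexify, hlog hA, hlog hB]
  refine CFC.log_le_log (complexify_le_complexify.mpr hAB) ?_
  rw [Matrix.isStrictlyPositive_iff_posDef,
    (posSemidef_complexify.mpr hA.posSemidef).posDef_iff_isUnit]
  exact hA.isUnit.map complexify

lemma norm_le_of_abs_le {D : Matrix n n ℝ} {c : ℝ} (hc : 0 ≤ c) (hD : IsSelfAdjoint D)
    (h1 : algebraMap ℝ _ (-c) ≤ D) (h2 : D ≤ algebraMap ℝ _ c) : ‖D‖ ≤ c := by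
  rw [← cfc_id' ℝ D]
  refine norm_cfc_le hc fun x hx => abs_le.mpr ⟨?_, ?_⟩
  · exact (algebraMap_le_iff_le_spectrum (A := Matrix n n ℝ)).mp h1 x hx
  · exact (le_algebraMap_iff_spectrum_le (A := Matrix n n ℝ)).mp h2 x hx

/-- Relative closeness in the Loewner order controls the difference of the logarithms. -/
lemma RelClose.norm_log_sub_log_le {A B : Matrix n n ℝ} (hA : A.PosDef) {ε : ℝ}
    (hε : ε ∈ Set.Ioo (0 : ℝ) 1) (h : RelClose ε A B) :
    ‖CFC.log B - CFC.log A‖ ≤ |Real.log (1 - ε)| := by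
  obtain ⟨hε0, hε1⟩ := hε
  have hAp : IsStrictlyPositive A := Matrix.isStrictlyPositive_iff_posDef.mpr hA
  have hlow : ((1 - ε) • A).PosDef := hA.smul (by linarith)
  have hB : B.PosDef := by
    have := hlow.add_posSemidef (Matrix.le_iff.mp h.1)
    rwa [add_sub_cancel] at this
  have hneg : Real.log (1 - ε) ≤ 0 := Real.log_nonpos (by linarith) (by linarith)
  -- From `(1 + ε)(1 - ε) ≤ 1`: the lower side dominates, so one constant serves both.
  have hcmp : Real.log (1 + ε) ≤ -Real.log (1 - ε) := by
    have h1 : (0 : ℝ) < 1 - ε := by linarith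
    have h2 : (0 : ℝ) < 1 + ε := by linarith
    rw [← Real.log_inv]
    refine Real.log_le_log h2 ?_
    rw [le_inv_comm₀ h2 h1, ← one_div, le_div_iff₀ h2]
    nlinarith
  have h1 := log_le_log hlow h.1
  have h2 := log_le_log hB h.2
  rw [CFC.log_smul' A (by linarith) hAp] at h1 h2
  rw [abs_of_nonpos hneg]
  refine norm_le_of_abs_le (by linarith) (IsSelfAdjoint.log.sub IsSelfAdjoint.log) ?_ ?_
  · rw [neg_neg]
    exact le_sub_iff_add_le.mpr h1
  · refine (sub_le_iff_le_add.mpr h2).trans ?_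
    exact algebraMap_mono _ hcmp

end Log

/-! ### Blocks as Gram matrices and the union bound -/

section Sketch

lemma posDef_primal {N : ℕ} {K : Fin N → ℕ} (β : ℝ) {cost : Matrix (Idx K) (Idx K) ℝ}
    {Lam : (i : Fin N) → Matrix (Fin (K i)) (Fin (K i)) ℝ} (hcost : cost.IsSymm)
    (hLam : ∀ i, (Lam i).IsSymm) : (primal β cost Lam).PosDef := by
  have hsa : IsSelfAdjoint (-β • effCost cost Lam) := by
    rw [IsSelfAdjoint, Matrix.star_eq_conjTranspose, Matrix.conjTranspose_eq_transpose_of_trivial,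
      Matrix.transpose_smul, effCost, Matrix.transpose_sub, Matrix.blockDiagonal'_transpose,
      hcost.eq]
    simp only [fun i => (hLam i).eq]
  exact (Matrix.nonneg_iff_posSemidef.mp hsa.exp_nonneg).posDef_iff_isUnit.mpr (Matrix.isUnit_exp _)

/-- The columns of the square root of `X` that belong to the block `i`. -/
noncomputable def sqrtCols {N : ℕ} {K : Fin N → ℕ} (X : Matrix (Idx K) (Idx K) ℝ) (i : Fin N) :
    Matrix (Idx K) (Fin (K i)) ℝ :=
  (CFC.sqrt X).submatrix id fun k => ⟨i, k⟩

lemma transpose_sqrt {n : Type*} [Fintype n] [DecidableEq n] (X : Matrix n n ℝ) :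
    (CFC.sqrt X)ᵀ = CFC.sqrt X := by
  have h := (Matrix.nonneg_iff_posSemidef.mp (CFC.sqrt_nonneg X)).isHermitian
  rwa [Matrix.IsHermitian, Matrix.conjTranspose_eq_transpose_of_trivial] at h

lemma blockDiag'_eq_sqrtCols {N : ℕ} {K : Fin N → ℕ} {X : Matrix (Idx K) (Idx K) ℝ}
    (hX : X.PosSemidef) (i : Fin N) : X.blockDiag' i = (sqrtCols X i)ᵀ * sqrtCols X i := by
  have h : X = (CFC.sqrt X)ᵀ * CFC.sqrt X := by
    rw [transpose_sqrt, CFC.sqrt_mul_sqrt_self X hX.nonneg]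
  ext k l
  conv_lhs => rw [h]
  rfl

lemma blockDiag'_sketch_eq {N : ℕ} {K : Fin N → ℕ} {S : ℕ} (X : Matrix (Idx K) (Idx K) ℝ)
    (Z : Matrix (Idx K) (Fin S) ℝ) (i : Fin N) :
    (sketch X Z).blockDiag' i = (1 / (S : ℝ)) • ((Zᵀ * sqrtCols X i)ᵀ * (Zᵀ * sqrtCols X i)) := by
  have h : CFC.sqrt X * Z * Zᵀ * CFC.sqrt X = (Zᵀ * CFC.sqrt X)ᵀ * (Zᵀ * CFC.sqrt X) := by
    rw [Matrix.transpose_mul, Matrix.transpose_transpose, transpose_sqrt]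
    simp only [Matrix.mul_assoc]
  ext k l
  rw [sketch, h]
  rfl

lemma dotProduct_gram {m n : Type*} [Fintype m] [Fintype n] (M : Matrix m n ℝ) (v : n → ℝ) :
    v ⬝ᵥ ((Mᵀ * M) *ᵥ v) = (M *ᵥ v) ⬝ᵥ (M *ᵥ v) := by
  rw [← Matrix.mulVec_mulVec, Matrix.dotProduct_mulVec, Matrix.vecMul_transpose]

/-- It suffices to compare the quadratic forms of two Gram matrices. -/
lemma relClose_gram {m n l : Type*} [Fintype m] [Fintype n] [Fintype l] {W : Matrix m n ℝ}
    {Y : Matrix l n ℝ} {r ε : ℝ}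
    (h : ∀ v, |r * ((Y *ᵥ v) ⬝ᵥ (Y *ᵥ v)) - (W *ᵥ v) ⬝ᵥ (W *ᵥ v)|
      ≤ ε * ((W *ᵥ v) ⬝ᵥ (W *ᵥ v))) :
    RelClose ε (Wᵀ * W) (r • (Yᵀ * Y)) := by
  have hW : (Wᵀ * W).IsHermitian := Matrix.isHermitian_conjTranspose_mul_self W
  have hY : (Yᵀ * Y).IsHermitian := Matrix.isHermitian_conjTranspose_mul_self Y
  have hsmul : ∀ (c : ℝ) {M : Matrix n n ℝ}, M.IsHermitian → (c • M).IsHermitian :=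
    fun c M hM => hM.smul (IsSelfAdjoint.all c)
  constructor
  · refine Matrix.le_iff.mpr (.of_dotProduct_mulVec_nonneg ((hsmul _ hY).sub (hsmul _ hW)) ?_)
    intro v
    have := (abs_le.mp (h v)).1
    rw [star_trivial, Matrix.sub_mulVec, dotProduct_sub, Matrix.smul_mulVec, Matrix.smul_mulVec,
      dotProduct_smul, dotProduct_smul, dotProduct_gram, dotProduct_gram, smul_eq_mul, smul_eq_mul]
    linarith
  · refine Matrix.le_iff.mpr (.of_dotProduct_mulVec_nonneg ((hsmul _ hW).sub (hsmul _ hY)) ?_)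
    intro v
    have := (abs_le.mp (h v)).2
    rw [star_trivial, Matrix.sub_mulVec, dotProduct_sub, Matrix.smul_mulVec, Matrix.smul_mulVec,
      dotProduct_smul, dotProduct_smul, dotProduct_gram, dotProduct_gram, smul_eq_mul, smul_eq_mul]
    linarith

/-- Relative closeness of `Wᵀ W` and its sketch `Wᵀ Z Zᵀ W / S` need only be tested on at most
`5 ^ d` unit vectors, where `d` is the number of columns of `W`. -/
lemma exists_net_relClose {m n l : Type*} [Fintype m] [Fintype n] [Fintype l]
    [Nonempty l] (W : Matrix m n ℝ) :
    ∃ s : Finset (m → ℝ), s.card ≤ 5 ^ Fintype.card n ∧ (∀ a ∈ s, ∑ k, a k ^ 2 = 1) ∧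
      ∀ {ε : ℝ}, 0 ≤ ε → ∀ Z : Matrix m l ℝ,
        (∀ a ∈ s, |∑ j, (∑ k, a k * Z k j) ^ 2 - Fintype.card l| ≤ Fintype.card l * (ε / 2)) →
        RelClose ε (Wᵀ * W) ((1 / (Fintype.card l : ℝ)) • ((Zᵀ * W)ᵀ * (Zᵀ * W))) := by
  classical
  let V : Submodule ℝ (EuclideanSpace ℝ m) := LinearMap.range (Matrix.toEuclideanLin W)
  have hdim : Module.finrank ℝ V ≤ Fintype.card n := by
    simpa using LinearMap.finrank_range_le (Matrix.toEuclideanLin W)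
  obtain ⟨s, hcard, hunit, hnet⟩ := exists_half_net_sphere V
  refine ⟨s.image fun y : V => WithLp.ofLp (y : EuclideanSpace ℝ m),
    Finset.card_image_le.trans (hcard.trans (Nat.pow_le_pow_right (by norm_num) hdim)), ?_, ?_⟩
  · simp only [Finset.forall_mem_image]
    intro y hy
    have h := hunit y hy
    rw [← Submodule.norm_coe] at h
    have h2 := EuclideanSpace.real_norm_sq_eq (y : EuclideanSpace ℝ m)
    rw [h, one_pow] at h2
    exact h2.symm
  · intro ε hε Z hZ
    simp only [Finset.forall_mem_image] at hZ
    set c : ℝ := (Fintype.card l : ℝ)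
    have hc : 0 < c := Nat.cast_pos.mpr Fintype.card_pos
    let T : V →ₗ[ℝ] EuclideanSpace ℝ l := Matrix.toEuclideanLin Zᵀ ∘ₗ V.subtype
    -- The polarized error `‖Zᵀ x‖² / c - ‖x‖²`, restricted to the column space of `W`.
    let B : V →ₗ[ℝ] V →ₗ[ℝ] ℝ :=
      (1 / c) • (innerₗ (EuclideanSpace ℝ l)).compl₁₂ T T - innerₗ V
    have hBapp : ∀ x y, B x y = 1 / c * inner ℝ (T x) (T y) - inner ℝ x y := fun x y => rfl
    have hTnorm : ∀ x : V, ‖T x‖ ^ 2 = ∑ j, (∑ k, (x : EuclideanSpace ℝ m) k * Z k j) ^ 2 := by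
      intro x
      rw [EuclideanSpace.real_norm_sq_eq]
      refine Finset.sum_congr rfl fun j _ => ?_
      congr 1
      simp [T, Matrix.toLpLin_apply, Matrix.mulVec, dotProduct, mul_comm]
    have hBdiag : ∀ x : V, B x x = 1 / c * ‖T x‖ ^ 2 - ‖x‖ ^ 2 := fun x => by
      rw [hBapp, real_inner_self_eq_norm_sq, real_inner_self_eq_norm_sq]
    have hmain := abs_le_of_abs_le_on_net hunit hnet B
      (fun x y => by rw [hBapp, hBapp, real_inner_comm, real_inner_comm x]) hε fun y hy => by
        have h := hZ hy
        rw [hBdiag, hunit y hy, hTnorm]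
        have hrw : ∀ q : ℝ, 1 / c * q - 1 ^ 2 = (1 / c) * (q - c) := fun q => by
          field_simp
        rw [hrw, abs_mul, abs_of_pos (by positivity : 0 < 1 / c)]
        calc _ ≤ 1 / c * (c * (ε / 2)) := by gcongr
          _ = ε / 2 := by field_simp
    refine relClose_gram fun v => ?_
    let x : V := ⟨Matrix.toEuclideanLin W (WithLp.toLp 2 v), LinearMap.mem_range_self _ _⟩
    have h := hmain x
    have hx : ‖x‖ ^ 2 = (W *ᵥ v) ⬝ᵥ (W *ᵥ v) := by
      rw [← Submodule.norm_coe, EuclideanSpace.real_norm_sq_eq]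
      simp [x, Matrix.toLpLin_apply, dotProduct, sq]
    have hTx : ‖T x‖ ^ 2 = ((Zᵀ * W) *ᵥ v) ⬝ᵥ ((Zᵀ * W) *ᵥ v) := by
      rw [EuclideanSpace.real_norm_sq_eq]
      simp [x, T, Matrix.toLpLin_apply, dotProduct, sq, Matrix.mulVec_mulVec]
    rwa [hBdiag, hx, hTx] at h

/-- The union bound over the blocks and over the points of the nets. -/
lemma measureReal_relClose_ge {N : ℕ} {K : Fin N → ℕ} {S : ℕ} (hS : 0 < S)
    {X : Matrix (Idx K) (Idx K) ℝ} (hX : X.PosSemidef) {Ω : Type*} [MeasurableSpace Ω]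
    {μ : Measure Ω} [IsProbabilityMeasure μ] {Z : Ω → Matrix (Idx K) (Fin S) ℝ}
    (hZ : IsGaussianSketch Z μ) {ε : ℝ} (hε : ε ∈ Set.Ioo (0 : ℝ) 1) :
    1 - N * 5 ^ maxBlock K * (2 * Real.exp (-(S * ε ^ 2 / 64))) ≤
      μ.real {ω | ∀ i, RelClose ε (X.blockDiag' i) ((sketch X (Z ω)).blockDiag' i)} := by
  have : Nonempty (Fin S) := ⟨⟨0, hS⟩⟩
  choose s hcard hunit hclose using fun i => exists_net_relClose (l := Fin S) (sqrtCols X i)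
  simp only [Fintype.card_fin] at hcard hclose
  set good := {ω | ∀ i, RelClose ε (X.blockDiag' i) ((sketch X (Z ω)).blockDiag' i)}
  let bad : (Idx K → ℝ) → Set Ω := fun a =>
    {ω | S * (ε / 2) ≤ |∑ j, (∑ k, a k * Z ω k j) ^ 2 - S|}
  have hsub : goodᶜ ⊆ ⋃ i, ⋃ a ∈ s i, bad a := by
    intro ω hω
    by_contra hnot
    refine hω fun i => ?_
    rw [blockDiag'_eq_sqrtCols hX, blockDiag'_sketch_eq]
    refine hclose i hε.1.le (Z ω) fun a ha => ?_
    by_contra! hlt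
    exact hnot (Set.mem_iUnion.mpr ⟨i, Set.mem_iUnion₂.mpr ⟨a, ha, hlt.le⟩⟩)
  have hbad : ∀ i, ∀ a ∈ s i, μ.real (bad a) ≤ 2 * Real.exp (-(S * ε ^ 2 / 64)) := by
    intro i a ha
    -- Net points must meet the tolerance `ε / 2`; this turns `t² / 16` into `ε² / 64`.
    have h := hZ.measureReal_abs_sub_ge (hunit i a ha) (t := ε / 2) (by linarith [hε.1])
      (by linarith [hε.2])
    simp only [Fintype.card_fin] at h
    convert h using 4
    ring
  have hblock : ∀ i, μ.real (⋃ a ∈ s i, bad a)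
      ≤ 5 ^ maxBlock K * (2 * Real.exp (-(S * ε ^ 2 / 64))) := by
    intro i
    calc μ.real (⋃ a ∈ s i, bad a) ≤ ∑ a ∈ s i, μ.real (bad a) :=
          measureReal_biUnion_finset_le _ _
      _ ≤ ∑ a ∈ s i, 2 * Real.exp (-(S * ε ^ 2 / 64)) := Finset.sum_le_sum (hbad i)
      _ = (s i).card * (2 * Real.exp (-(S * ε ^ 2 / 64))) := by simp
      _ ≤ _ := by
        gcongr
        have h : (s i).card ≤ 5 ^ maxBlock K := (hcard i).trans
          (Nat.pow_le_pow_right (by norm_num) (Finset.le_sup (f := K) (Finset.mem_univ i)))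
        exact_mod_cast h
  have htotal : μ.real goodᶜ ≤ N * 5 ^ maxBlock K * (2 * Real.exp (-(S * ε ^ 2 / 64))) :=
    calc μ.real goodᶜ ≤ μ.real (⋃ i, ⋃ a ∈ s i, bad a) := measureReal_mono hsub
      _ ≤ ∑ i, μ.real (⋃ a ∈ s i, bad a) := measureReal_iUnion_fintype_le _
      _ ≤ ∑ _i : Fin N, 5 ^ maxBlock K * (2 * Real.exp (-(S * ε ^ 2 / 64))) :=
          Finset.sum_le_sum fun i _ => hblock i
      _ = _ := by simp [mul_assoc]
  -- Subadditivity suffices here, so `good` need not be shown measurable.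
  have hone : 1 ≤ μ.real good + μ.real goodᶜ := by
    have h := measureReal_union_le (μ := μ) good goodᶜ
    rwa [Set.union_compl_self, probReal_univ] at h
  linarith

end Sketch

/-! ### Choice of the sample size -/

section SampleSize

/-- Keeps `log (N / δ)` away from zero, so that it can absorb the net entropy; for `N = 1` and `δ`
near `1` it would degenerate, which is where `δ₀` enters. -/
lemma le_log_div {δ₀ δ : ℝ} (hδ : δ ∈ Set.Ioo (0 : ℝ) 1) {N : ℕ}
    (hN : 1 ≤ N) (h : 2 ≤ N ∨ δ ≤ δ₀) :
    min (Real.log 2) (-Real.log δ₀) ≤ Real.log (N / δ) := by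
  have hN' : (1 : ℝ) ≤ N := by exact_mod_cast hN
  rw [Real.log_div (by positivity) hδ.1.ne']
  rcases h with h | h
  · have h2 : Real.log 2 ≤ Real.log N := Real.log_le_log two_pos (by exact_mod_cast h)
    have := Real.log_nonpos hδ.1.le hδ.2.le
    exact (min_le_left _ _).trans (by linarith)
  · have := Real.log_le_log hδ.1 h
    have := Real.log_nonneg hN'
    exact (min_le_right _ _).trans (by linarith)

/-- The sample size at which the union bound over the nets drops below `δ`. -/
lemma union_bound_le {c ε δ : ℝ} (hc : 0 < c) (hε : 0 < ε) (hδ : 0 < δ) {N K S : ℕ} (hN : 1 ≤ N)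
    (hK : 2 ≤ K) (hlog : c ≤ Real.log (N / δ))
    (hS : 64 * (1 + 10 / c) * Real.log (N / δ) / ε ^ 2 * (K * Real.log K) ≤ S) :
    N * 5 ^ K * (2 * Real.exp (-(S * ε ^ 2 / 64))) ≤ δ := by
  have hN' : (0 : ℝ) < N := by exact_mod_cast hN
  have hK' : (2 : ℝ) ≤ K := by exact_mod_cast hK
  set ℓ := Real.log (N / δ) with hℓ
  set Q : ℝ := K * Real.log K
  have hlog2 : 1 / 2 < Real.log 2 := by linarith [Real.log_two_gt_d9]
  have hlogK : Real.log 2 ≤ Real.log K := Real.log_le_log two_pos hK'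
  have hQ : (K : ℝ) / 2 ≤ Q := by
    have : (K : ℝ) * (1 / 2) ≤ K * Real.log K := by gcongr; linarith
    linarith
  have hS' : (1 + 10 / c) * ℓ * Q ≤ S * ε ^ 2 / 64 := by
    have h := mul_le_mul_of_nonneg_right hS (sq_nonneg ε)
    have hrw : 64 * (1 + 10 / c) * ℓ / ε ^ 2 * Q * ε ^ 2 = 64 * ((1 + 10 / c) * ℓ * Q) := by
      field_simp
    rw [hrw] at h
    linarith
  have hlog5 : Real.log 5 ≤ 4 := by linarith [Real.log_le_sub_one_of_pos (x := 5) (by norm_num)]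
  have hlog2' : Real.log 2 ≤ 1 := by linarith [Real.log_le_sub_one_of_pos (x := 2) (by norm_num)]
  -- With `Q ≥ K / 2 ≥ 1`: `K log 5 ≤ 4K ≤ 8Q` and `log 2 ≤ Q`, so `10 Q` covers the entropy, and `ℓ
  -- ≥ c` pays for it through `10 / c`. The factor `log K` is used only for `Q ≥ K / 2`.
  have hexp : ℓ + K * Real.log 5 + Real.log 2 ≤ S * ε ^ 2 / 64 := by
    refine le_trans ?_ hS'
    have h1 : ℓ ≤ ℓ * Q := le_mul_of_one_le_right (hc.le.trans hlog) (by linarith)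
    have h2 : (K : ℝ) * Real.log 5 ≤ K * 4 := by gcongr
    have h3 : 10 * Q ≤ 10 / c * ℓ * Q := by
      have : 10 ≤ 10 / c * ℓ := by
        rw [div_mul_eq_mul_div, le_div_iff₀ hc]
        linarith
      gcongr
    linarith
  have hprod : N * 5 ^ K * 2 = δ * Real.exp (ℓ + K * Real.log 5 + Real.log 2) := by
    rw [Real.exp_add, Real.exp_add, hℓ, Real.exp_log (by positivity), Real.exp_nat_mul,
      Real.exp_log (by norm_num), Real.exp_log two_pos]
    field_simp
  rw [← mul_assoc, hprod, mul_assoc, ← Real.exp_add]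
  exact mul_le_of_le_one_right hδ.le (Real.exp_le_one_iff.mpr (by linarith))

end SampleSize

end BlockSketch

theorem mainTheorem3 (δ₀ : ℝ) (hδ₀ : δ₀ ∈ Set.Ioo (0 : ℝ) 1) :
    ∃ C : ℝ, 0 < C ∧
      ∀ (ε δ : ℝ), ε ∈ Set.Ioo (0 : ℝ) 1 → δ ∈ Set.Ioo (0 : ℝ) 1 →
      ∀ (N : ℕ) (K : Fin N → ℕ),
        (2 ≤ N ∨ δ ≤ δ₀) → 2 ≤ BlockSketch.maxBlock K →
      ∀ (β : ℝ), 0 < β →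
      ∀ (cost : Matrix (BlockSketch.Idx K) (BlockSketch.Idx K) ℝ)
        (Lam : (i : Fin N) → Matrix (Fin (K i)) (Fin (K i)) ℝ),
        cost.IsSymm → (∀ i, (Lam i).IsSymm) →
      ∀ (S : ℕ),
        C * Real.log (N / δ) / ε ^ 2 *
          (BlockSketch.maxBlock K * Real.log (BlockSketch.maxBlock K)) ≤ S →
      ∀ {Ω : Type*} [MeasurableSpace Ω] (μ : Measure Ω) [IsProbabilityMeasure μ]
        (Z : Ω → Matrix (BlockSketch.Idx K) (Fin S) ℝ), BlockSketch.IsGaussianSketch Z μ →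
      ∀ (X : Matrix (BlockSketch.Idx K) (BlockSketch.Idx K) ℝ)
        (Xhat : Ω → Matrix (BlockSketch.Idx K) (BlockSketch.Idx K) ℝ),
        X = BlockSketch.primal β cost Lam → (∀ ω, Xhat ω = BlockSketch.sketch X (Z ω)) →
      1 - δ ≤ μ.real {ω | ∀ i,
          BlockSketch.RelClose ε (X.blockDiag' i) ((Xhat ω).blockDiag' i) ∧
          ‖CFC.log ((Xhat ω).blockDiag' i) - CFC.log (X.blockDiag' i)‖ ≤ |Real.log (1 - ε)|} ∧
      ∀ ω i, BlockSketch.RelClose ε (X.blockDiag' i) ((Xhat ω).blockDiag' i) →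
          ‖CFC.log ((Xhat ω).blockDiag' i) - CFC.log (X.blockDiag' i)‖ ≤ |Real.log (1 - ε)| := by
  set c := min (Real.log 2) (-Real.log δ₀)
  have hc : 0 < c := lt_min (Real.log_pos one_lt_two) (neg_pos.mpr (Real.log_neg hδ₀.1 hδ₀.2))
  refine ⟨64 * (1 + 10 / c), by positivity, ?_⟩
  intro ε δ hε hδ N K hNδ hK β _ cost Lam hcost hLam S hS Ω _ μ _ Z hZ X Xhat hXdef hXhat
  have hX : X.PosDef := hXdef ▸ BlockSketch.posDef_primal β hcost hLam
  -- A diagonal block is a principal submatrix.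
  have hblock : ∀ i, (X.blockDiag' i).PosDef := fun i =>
    hX.submatrix (sigma_mk_injective (i := i))
  have hlogbound : ∀ ω i, BlockSketch.RelClose ε (X.blockDiag' i) ((Xhat ω).blockDiag' i) →
      ‖CFC.log ((Xhat ω).blockDiag' i) - CFC.log (X.blockDiag' i)‖ ≤ |Real.log (1 - ε)| :=
    fun ω i h => h.norm_log_sub_log_le (hblock i) hε
  refine ⟨?_, hlogbound⟩
  have hN : 1 ≤ N := by
    rcases Nat.eq_zero_or_pos N with rfl | h
    · simp [BlockSketch.maxBlock] at hK
    · exact h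
  have hlog := BlockSketch.le_log_div hδ hN hNδ
  have hS0 : 0 < S := by
    have hK' : (1 : ℝ) < BlockSketch.maxBlock K := by exact_mod_cast hK
    have : (0 : ℝ) < S := lt_of_lt_of_le (by
      have := Real.log_pos hK'
      have := hc.trans_le hlog
      have := hε.1
      positivity) hS
    exact_mod_cast this
  have hprob := BlockSketch.measureReal_relClose_ge hS0 hX.posSemidef hZ hε
  have hsmall := BlockSketch.union_bound_le hc hε.1 hδ.1 hN hK hlog hS
  refine le_trans (by linarith) (hprob.trans (measureReal_mono fun ω hω i => ?_))
  have hi : BlockSketch.RelClose ε (X.blockDiag' i) ((Xhat ω).blockDiag' i) := by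
    rw [hXhat ω]; exact hω i
  exact ⟨hi, hlogbound ω i hi⟩
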